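/- **Setting.** Let $K$ be a field and let $f\in K(z)$ be a separable rational function (i.e. its derivative $f'$ is not identically zero) of degree $d\ge 2$. Let $t$ be transcendental over $K$, fix a separable closure $\Omega=K(t)^{\mathrm{sep}}$ of $K(t)$, and let $K^{\mathrm{sep}}$ be the separable closure of $K$ in $\Omega$. Let $T=\bigsqcup_{n\ge 0}f^{-n}(t)$ be the rooted tree of iterated preimages of $t$ in $\Omega$, where $z\in f^{-(n+1)}(t)$ is joined to $f(z)\in f^{-n}(t)$. For a field $L$ with $K\subseteq L\subseteq K^{\mathrm{sep}}$ let $G_\infty(L,f,t)$ be the image of $\mathrm{Gal}(\Omega/L(t))$ in $\mathrm{Aut}\,T$. Put $G=G_\infty(K,f,t)$ (the arithmetic iterated Galois group) and $H=G_\infty(K^{\mathrm{sep}},f,t)$ (the geometric one). For $1\le n<\infty$ let $K_n(f,t)$ be the field generated over $K(t)$ by $\bigcup_{1\le k\le n}f^{-k}(t)$, let $K_\infty(f,t)=\bigcup_{n}K_n(f,t)$, and let $L_\infty=K_\infty(f,t)\cap K^{\mathrm{sep}}$. Enumerate $f^{-1}(t)=\{t_1,\dots,t_d\}$ and choose, for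 each $i$, an automorphism $\lambda_i$ of $\Omega$ over $K^{\mathrm{sep}}$ with $\lambda_i(t)=t_i$ (a path from $t$ to $t_i$). Identify $T$ with the $d$-adic tree of words over $\{1,\dots,d\}$ by letting the word $i_1i_2\cdots i_n$ correspond to the vertex $\lambda_{i_1}(\lambda_{i_2}(\cdots\lambda_{i_n}(t)))\in f^{-n}(t)$. For a tree automorphism $g$ and a word $v$, the section $g|_v$ is the tree automorphism with $g(vw)=g(v)\,g|_v(w)$ for all words $w$; $\pi_n$ denotes the action on the finite tree $T^n$ of the words of length at most $n$. A subgroup $\Gamma\le\mathrm{Aut}\,T$ is *branch* if it acts transitively on every level of $T$ and, for every $n\ge1$, the subgroup of $\Gamma$ generated by (which is the direct product of) the rigid stabilizers $\mathrm{rist}_\Gamma(v)=\{g\in\Gamma: g \text{ fixes every vertex that does not lie below } v\}$, for $v$ of level $n$, has finite index in $\Gamma$. It is *of finite type of depth $D$*, where $D\ge1$, if there is a subgroup $\mathcal P\le\mathrm{Aut}\,T^D$ such that $\Gamma=\{g\in\mathrm{Aut}\,T:\pi_D(g|_v)\in\mathcal P\text{ for all }v\}$. **Theorem.** For every choice of the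 paths $\lambda_1,\dots,\lambda_d$: (i) $H$ is branch if and only if $G$ is branch. (ii) If $H$ or $G$ is branch, then $H$ is of finite type of some depth $D\ge 1$, and for every $D\ge1$ such that $H$ is of finite type of depth $D$ (in particular for the least one) $$[L_\infty:K]=|G:H|=|\pi_D(G):\pi_D(H)|<\infty\qquad\text{and}\qquad L_\infty=K_D(f,t)\cap K^{\mathrm{sep}}.$$ -/

import Mathlib

namespace IteratedGalois

/-! ### The rooted tree of words and its automorphism group -/

/-- Automorphisms of the rooted tree whose vertices are the words over the alphabet `X` (the root is
the empty word, the immediate descendants of `v` are the words `v ++ [x]`): the bijections that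
preserve the ancestor relation, which is the prefix relation. For `X = Fin d` this is the
automorphism group of the `d`-adic tree. -/
abbrev TreeAut (X : Type*) : Type _ :=
  (fun u v : List X => u <+: v) ≃r (fun u v : List X => u <+: v)

/-- Automorphisms of the truncated tree of the words of length at most `n`. -/
abbrev TruncAut (X : Type*) (n : ℕ) : Type _ :=
  (fun u v : {w : List X // w.length ≤ n} => u.1 <+: v.1) ≃r
    (fun u v : {w : List X // w.length ≤ n} => u.1 <+: v.1)

section Tree

variable {X : Type*}

theorem TreeAut.apply_inv (g : TreeAut X) (w : List X) : g (g⁻¹ w) = w :=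
  g.apply_symm_apply w

theorem TreeAut.inv_apply (g : TreeAut X) (w : List X) : g⁻¹ (g w) = w :=
  g.symm_apply_apply w

theorem TreeAut.prefix_iff (g : TreeAut X) {u v : List X} : g u <+: g v ↔ u <+: v :=
  g.map_rel_iff

theorem TreeAut.length_le (g : TreeAut X) (w : List X) : w.length ≤ (g w).length := by
  induction w using List.reverseRecOn with
  | nil => simp
  | append_singleton u a ih =>
    have h1 : g u <+: g (u ++ [a]) := g.prefix_iff.2 (List.prefix_append _ _)
    have h2 : (g u).length ≠ (g (u ++ [a])).length := by
      intro h
      have := g.injective (h1.eq_of_length h)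
      simp at this
    have h3 := h1.length_le
    simp only [List.length_append, List.length_singleton]
    omega

/-- A tree automorphism preserves the levels. -/
theorem TreeAut.length_apply (g : TreeAut X) (w : List X) : (g w).length = w.length := by
  refine le_antisymm ?_ (g.length_le w)
  simpa [TreeAut.inv_apply] using (g⁻¹).length_le (g w)

theorem TreeAut.apply_append (g : TreeAut X) (v w : List X) :
    g (v ++ w) = g v ++ (g (v ++ w)).drop v.length := by
  obtain ⟨s, hs⟩ : g v <+: g (v ++ w) := g.prefix_iff.2 (List.prefix_append _ _)
  rw [← hs, List.drop_left' (g.length_apply v)]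

/-- The section `g|_v`, characterised by `g (v ++ w) = g v ++ g|_v w`. -/
def TreeAut.sect (g : TreeAut X) (v : List X) : TreeAut X where
  toFun w := (g (v ++ w)).drop v.length
  invFun w := (g⁻¹ (g v ++ w)).drop v.length
  left_inv w := by
    simp only
    rw [← g.apply_append, g.inv_apply, List.drop_left]
  right_inv w := by
    have h := (g⁻¹).apply_append (g v) w
    rw [g.inv_apply, g.length_apply] at h
    simp only
    rw [← h, g.apply_inv, List.drop_left' (g.length_apply v)]
  map_rel_iff' := by
    intro a b
    simp only [Equiv.coe_fn_mk]
    rw [← List.prefix_append_right_inj (g v), ← g.apply_append, ← g.apply_append, g.prefix_iff,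
      List.prefix_append_right_inj]

theorem TreeAut.apply_append_sect (g : TreeAut X) (v w : List X) :
    g (v ++ w) = g v ++ g.sect v w :=
  g.apply_append v w

theorem TreeAut.sect_one (v : List X) : (1 : TreeAut X).sect v = 1 := by
  ext1 w
  exact List.append_cancel_left ((1 : TreeAut X).apply_append_sect v w).symm

theorem TreeAut.sect_mul (g h : TreeAut X) (v : List X) :
    (g * h).sect v = g.sect (h v) * h.sect v := by
  ext1 w
  apply List.append_cancel_left (as := (g * h) v)
  rw [← TreeAut.apply_append_sect]
  change g (h (v ++ w)) = g (h v) ++ g.sect (h v) (h.sect v w)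
  rw [h.apply_append_sect, g.apply_append_sect]

theorem TreeAut.sect_inv (g : TreeAut X) (v : List X) :
    (g⁻¹).sect v = (g.sect (g⁻¹ v))⁻¹ := by
  rw [eq_inv_iff_mul_eq_one]
  have h := TreeAut.sect_mul g⁻¹ g (g⁻¹ v)
  rw [inv_mul_cancel, TreeAut.sect_one, g.apply_inv] at h
  exact h.symm

/-- `π_n`: the action of a tree automorphism on the truncated tree of depth `n`. -/
def truncHom (X : Type*) (n : ℕ) : TreeAut X →* TruncAut X n where
  toFun g :=
    { toFun := fun w => ⟨g w.1, (g.length_apply w.1).trans_le w.2⟩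
      invFun := fun w => ⟨g⁻¹ w.1, ((g⁻¹).length_apply w.1).trans_le w.2⟩
      left_inv := fun w => Subtype.ext (g.inv_apply w.1)
      right_inv := fun w => Subtype.ext (g.apply_inv w.1)
      map_rel_iff' := g.prefix_iff }
  map_one' := rfl
  map_mul' _ _ := rfl

/-- `G` acts transitively on every level of the tree. -/
def IsLevelTransitive (G : Subgroup (TreeAut X)) : Prop :=
  ∀ u v : List X, u.length = v.length → ∃ g ∈ G, g u = v

/-- The rigid vertex stabilizer of `v` in `G`: the elements of `G` that move only vertices
below `v`. -/
def rist (G : Subgroup (TreeAut X)) (v : List X) : Subgroup (TreeAut X) where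
  carrier := {g | g ∈ G ∧ ∀ w : List X, ¬ v <+: w → g w = w}
  one_mem' := ⟨G.one_mem, fun _ _ => rfl⟩
  mul_mem' := by
    rintro g h ⟨hg, hg'⟩ ⟨hh, hh'⟩
    refine ⟨G.mul_mem hg hh, fun w hw => ?_⟩
    change g (h w) = w
    rw [hh' w hw, hg' w hw]
  inv_mem' := by
    rintro g ⟨hg, hg'⟩
    refine ⟨G.inv_mem hg, fun w hw => ?_⟩
    apply g.injective
    rw [g.apply_inv, hg' w hw]

/-- The rigid level stabilizer: the (internal direct) product of the rigid vertex stabilizers of the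
vertices of level `n`. -/
def levelRist (G : Subgroup (TreeAut X)) (n : ℕ) : Subgroup (TreeAut X) :=
  ⨆ v : {v : List X // v.length = n}, rist G v.1

/-- `G` is branch: it is level-transitive and its rigid level stabilizers have finite index. -/
def IsBranch (G : Subgroup (TreeAut X)) : Prop :=
  IsLevelTransitive G ∧ ∀ n : ℕ, 1 ≤ n → ((levelRist G n).subgroupOf G).FiniteIndex

/-- The group of finite type defined by a group `P` of automorphisms of the truncated tree of
depth `D`: all tree automorphisms all of whose sections of depth `D` lie in `P`. -/
def finiteTypeGroup {D : ℕ} (P : Subgroup (TruncAut X D)) : Subgroup (TreeAut X) where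
  carrier := {g | ∀ v : List X, truncHom X D (g.sect v) ∈ P}
  one_mem' v := by
    rw [TreeAut.sect_one, map_one]
    exact P.one_mem
  mul_mem' := by
    intro g h hg hh v
    rw [TreeAut.sect_mul, map_mul]
    exact P.mul_mem (hg _) (hh _)
  inv_mem' := by
    intro g hg v
    rw [TreeAut.sect_inv, map_inv]
    exact P.inv_mem (hg _)

/-- `G` is a group of finite type of depth `D`. -/
def IsOfFiniteType (G : Subgroup (TreeAut X)) (D : ℕ) : Prop :=
  1 ≤ D ∧ ∃ P : Subgroup (TruncAut X D), G = finiteTypeGroup P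

end Tree

/-! ### Rational functions and the tree of preimages -/

section Galois

variable {K Ω : Type*} [Field K] [Field Ω] [Algebra K Ω]

/-- The degree of a rational function, as a self-map of the projective line. -/
noncomputable def ratDegree (f : RatFunc K) : ℕ :=
  max f.num.natDegree f.denom.natDegree

/-- The rational function `f` is separable: its derivative (here the numerator of the quotient rule)
does not vanish identically. -/
def IsSeparableRat (f : RatFunc K) : Prop :=
  Polynomial.derivative f.num * f.denom - f.num * Polynomial.derivative f.denom ≠ 0

/-- The value of `f` at a point of `Ω`. At a pole it is `0` by convention; a pole is algebraic over
`K` and hence is never an iterated preimage of a transcendental element. -/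
noncomputable def evalRat (f : RatFunc K) (z : Ω) : Ω :=
  Polynomial.aeval z f.num / Polynomial.aeval z f.denom

theorem evalRat_algEquiv (f : RatFunc K) (σ : Ω ≃ₐ[K] Ω) (z : Ω) :
    evalRat f (σ z) = σ (evalRat f z) := by
  simp only [evalRat, map_div₀, Polynomial.aeval_algEquiv, AlgHom.comp_apply]
  rfl

theorem iterate_evalRat_algEquiv (f : RatFunc K) (σ : Ω ≃ₐ[K] Ω) (n : ℕ) (z : Ω) :
    (evalRat f)^[n] (σ z) = σ ((evalRat f)^[n] z) := by
  induction n generalizing z with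
  | zero => rfl
  | succ n ih => rw [Function.iterate_succ_apply, Function.iterate_succ_apply, evalRat_algEquiv, ih]

/-- The set `f^{-n}(t)`. -/
def iterPreimage (f : RatFunc K) (t : Ω) (n : ℕ) : Set Ω :=
  {z | (evalRat f)^[n] z = t}

/-- The vertices of the tree of preimages: the disjoint union of the sets `f^{-n}(t)`. -/
def PreimageTree (f : RatFunc K) (t : Ω) : Type _ :=
  Σ n : ℕ, iterPreimage f t n

/-- The ancestor relation in the tree of preimages: `y` in `f^{-m}(t)` is an ancestor of `z` in
`f^{-n}(t)` if `m ≤ n` and `f^{n-m}(z) = y`. -/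
def ancestor (f : RatFunc K) (t : Ω) (y z : PreimageTree f t) : Prop :=
  y.1 ≤ z.1 ∧ (evalRat f)^[z.1 - y.1] z.2.1 = y.2.1

/-- The Galois group `Gal(Ω / L(t))`, as a group of `K`-automorphisms of `Ω`. -/
def galOver (t : Ω) (L : IntermediateField K Ω) : Subgroup (Ω ≃ₐ[K] Ω) :=
  (IntermediateField.adjoin K ((L : Set Ω) ∪ {t})).fixingSubgroup

theorem galOver_apply (t : Ω) (L : IntermediateField K Ω) (σ : galOver t L) : σ.1 t = t :=
  σ.2 ⟨t, IntermediateField.subset_adjoin K _ (Or.inr rfl)⟩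

/-- The arboreal Galois representation `Gal(Ω / L(t)) → Aut T` given by the natural action on the
tree of preimages. -/
noncomputable def arborealRep (f : RatFunc K) (t : Ω) (L : IntermediateField K Ω) :
    galOver t L →* (ancestor f t ≃r ancestor f t) where
  toFun σ :=
    { toFun := fun z => ⟨z.1, σ.1 z.2.1, by
        have h : (evalRat f)^[z.1] z.2.1 = t := z.2.2
        change (evalRat f)^[z.1] (σ.1 z.2.1) = t
        rw [iterate_evalRat_algEquiv, h, galOver_apply]⟩
      invFun := fun z => ⟨z.1, (σ⁻¹).1 z.2.1, by
        have h : (evalRat f)^[z.1] z.2.1 = t := z.2.2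
        change (evalRat f)^[z.1] ((σ⁻¹).1 z.2.1) = t
        rw [iterate_evalRat_algEquiv, h, galOver_apply]⟩
      left_inv := fun z =>
        Sigma.ext rfl (heq_of_eq (Subtype.ext (σ.1.symm_apply_apply z.2.1)))
      right_inv := fun z =>
        Sigma.ext rfl (heq_of_eq (Subtype.ext (σ.1.apply_symm_apply z.2.1)))
      map_rel_iff' := by
        intro y z
        refine and_congr Iff.rfl ?_
        change (evalRat f)^[z.1 - y.1] (σ.1 z.2.1) = σ.1 y.2.1 ↔ _
        rw [iterate_evalRat_algEquiv, σ.1.injective.eq_iff] }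
  map_one' := rfl
  map_mul' _ _ := rfl

/-- A choice of paths: an enumeration `t_1, …, t_d` of `f^{-1}(t)`, where `d` is the degree of `f`,
and for every `i` an automorphism of `Ω` over the separable closure of `K` that maps `t` to `t_i`.
Here `Ω` is a separable closure of `K(t)`, and thus also of every `K(t_i)`. -/
structure PathSystem (f : RatFunc K) (t : Ω) where
  /-- the paths -/
  path : Fin (ratDegree f) → (Ω ≃ₐ[separableClosure K Ω] Ω)
  /-- the endpoints of the paths enumerate `f^{-1}(t)` -/
  bijOn : Set.BijOn (fun i => path i t) Set.univ {z | evalRat f z = t}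

namespace PathSystem

variable {f : RatFunc K} {t : Ω} (P : PathSystem f t)

/-- The vertex of the tree of preimages that is labelled by the word `i_1 i_2 … i_n`: the image
of `t` under the composite of the corresponding paths. -/
def vertex : List (Fin (ratDegree f)) → Ω
  | [] => t
  | i :: w => P.path i (vertex w)

theorem iterate_path (i : Fin (ratDegree f)) (n : ℕ) (z : Ω) :
    (evalRat f)^[n] (P.path i z) = P.path i ((evalRat f)^[n] z) :=
  iterate_evalRat_algEquiv f ((P.path i).restrictScalars K) n z

theorem iterate_path_symm (i : Fin (ratDegree f)) (n : ℕ) (z : Ω) :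
    (evalRat f)^[n] ((P.path i).symm z) = (P.path i).symm ((evalRat f)^[n] z) :=
  iterate_evalRat_algEquiv f ((P.path i).symm.restrictScalars K) n z

theorem evalRat_path (i : Fin (ratDegree f)) : evalRat f (P.path i t) = t :=
  P.bijOn.mapsTo (Set.mem_univ i)

theorem iterate_vertex (w : List (Fin (ratDegree f))) :
    (evalRat f)^[w.length] (P.vertex w) = t := by
  induction w with
  | nil => rfl
  | cons i w ih =>
    rw [List.length_cons, Function.iterate_succ_apply', vertex, iterate_path, ih, evalRat_path]

theorem iterate_vertex_append (u s : List (Fin (ratDegree f))) :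
    (evalRat f)^[s.length] (P.vertex (u ++ s)) = P.vertex u := by
  induction u with
  | nil => exact P.iterate_vertex s
  | cons i u ih => rw [List.cons_append, vertex, iterate_path, ih, vertex]

theorem vertex_injective (u v : List (Fin (ratDegree f))) (hl : u.length = v.length)
    (h : P.vertex u = P.vertex v) : u = v := by
  induction u generalizing v with
  | nil => exact (List.length_eq_zero_iff.1 hl.symm).symm
  | cons i u ih =>
    cases v with
    | nil => simp at hl
    | cons j v =>
      have hl' : u.length = v.length := by simpa using hl
      rw [vertex, vertex] at h
      have h1 := congrArg ((evalRat f)^[u.length]) h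
      rw [iterate_path, iterate_path, iterate_vertex, hl', iterate_vertex] at h1
      obtain rfl := P.bijOn.injOn (Set.mem_univ i) (Set.mem_univ j) h1
      rw [ih v hl' ((P.path i).injective h)]

theorem vertex_surjective (n : ℕ) (z : Ω) (hz : (evalRat f)^[n] z = t) :
    ∃ w : List (Fin (ratDegree f)), w.length = n ∧ P.vertex w = z := by
  induction n generalizing z with
  | zero => exact ⟨[], rfl, hz.symm⟩
  | succ n ih =>
    rw [Function.iterate_succ_apply'] at hz
    obtain ⟨i, -, hi⟩ := P.bijOn.surjOn hz
    obtain ⟨w, hw, hwz⟩ := ih ((P.path i).symm z) (by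
      rw [iterate_path_symm, ← hi, AlgEquiv.symm_apply_apply])
    exact ⟨i :: w, by simp [hw], by rw [vertex, hwz, AlgEquiv.apply_symm_apply]⟩

/-- The labelling of the vertices of the tree of preimages by words, as a map. -/
def labelFun (w : List (Fin (ratDegree f))) : PreimageTree f t :=
  ⟨w.length, P.vertex w, P.iterate_vertex w⟩

theorem labelFun_bijective : Function.Bijective P.labelFun := by
  constructor
  · intro u v h
    have h1 : u.length = v.length := congrArg Sigma.fst h
    have h2 : P.vertex u = P.vertex v :=
      congrArg (fun x : PreimageTree f t => x.2.1) h
    exact P.vertex_injective u v h1 h2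
  · rintro ⟨n, z, hz⟩
    obtain ⟨w, rfl, rfl⟩ := P.vertex_surjective n z hz
    exact ⟨w, rfl⟩

theorem ancestor_labelFun (u v : List (Fin (ratDegree f))) :
    ancestor f t (P.labelFun u) (P.labelFun v) ↔ u <+: v := by
  constructor
  · rintro ⟨h1, h2⟩
    change u.length ≤ v.length at h1
    change (evalRat f)^[v.length - u.length] (P.vertex v) = P.vertex u at h2
    have h3 := P.iterate_vertex_append (v.take u.length) (v.drop u.length)
    rw [List.take_append_drop, List.length_drop, h2] at h3
    rw [P.vertex_injective _ _ (by simpa using h1) h3]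
    exact List.take_prefix _ _
  · rintro ⟨s, rfl⟩
    refine ⟨by simp [labelFun], ?_⟩
    change (evalRat f)^[(u ++ s).length - u.length] (P.vertex (u ++ s)) = P.vertex u
    rw [List.length_append, Nat.add_sub_cancel_left, iterate_vertex_append]

/-- The labelling identifies the tree of words with the tree of preimages. -/
noncomputable def label :
    (fun u v : List (Fin (ratDegree f)) => u <+: v) ≃r ancestor f t where
  toEquiv := Equiv.ofBijective P.labelFun P.labelFun_bijective
  map_rel_iff' := P.ancestor_labelFun _ _

/-- The arboreal Galois representation of `Gal(Ω / L(t))` on the `d`-adic tree of words, to which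
the tree of preimages is identified by the labelling. -/
noncomputable def rep (L : IntermediateField K Ω) :
    galOver t L →* TreeAut (Fin (ratDegree f)) where
  toFun σ := (P.label.trans (arborealRep f t L σ)).trans P.label.symm
  map_one' := by
    ext1 w
    simp
  map_mul' σ τ := by
    ext1 w
    simp

/-- The iterated Galois group `G_∞(L, f, t)`: the image of the arboreal Galois representation
of `Gal(Ω / L(t))`. -/
noncomputable def iteratedGaloisGroup (L : IntermediateField K Ω) :
    Subgroup (TreeAut (Fin (ratDegree f))) :=
  (P.rep L).range

/-- The arithmetic iterated Galois group `G_∞(K, f, t)`. -/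
noncomputable def arithGroup : Subgroup (TreeAut (Fin (ratDegree f))) :=
  P.iteratedGaloisGroup ⊥

/-- The geometric iterated Galois group `G_∞(K^sep, f, t)`. -/
noncomputable def geomGroup : Subgroup (TreeAut (Fin (ratDegree f))) :=
  P.iteratedGaloisGroup (separableClosure K Ω)

end PathSystem

/-- The field `K_n(f, t)`: the splitting field over `K(t)` of the equations `f^k(z) = t` with
`1 ≤ k ≤ n`. -/
noncomputable def splittingFieldUpTo (f : RatFunc K) (t : Ω) (n : ℕ) : IntermediateField K Ω :=
  IntermediateField.adjoin K ({t} ∪ ⋃ k ∈ Set.Icc 1 n, iterPreimage f t k)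

/-- The field `K_∞(f, t)`: the splitting field over `K(t)` of all the equations `f^k(z) = t`. -/
noncomputable def splittingFieldAll (f : RatFunc K) (t : Ω) : IntermediateField K Ω :=
  IntermediateField.adjoin K ({t} ∪ ⋃ k ∈ Set.Ici 1, iterPreimage f t k)

/-- The field of constants `L_∞ = K_∞(f, t) ∩ K^sep`. -/
noncomputable def constantField (f : RatFunc K) (t : Ω) : IntermediateField K Ω :=
  splittingFieldAll f t ⊓ separableClosure K Ω

end Galois

end IteratedGalois

open IteratedGalois

namespace IteratedGalois

/-! ### Sections, level-closed and self-replicating groups -/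

section Tree

variable {X : Type*}

/-! Let g ∈ G be induced by σ, and let g(i) = j. Then the section g|_i is induced by λ_j⁻¹σλ_i. The
paths are trivial on K^sep, so this automorphism agrees with σ there. Hence g|_v ∈ gH for every word
v (`inv_mul_sect_mem_geomGroup`), and this congruence drives everything.

If G is branch, an element of rist_G(v) with v nonempty has trivial section at any letter other than
the first letter of v, so by the congruence it lies in H. Thus G and H have the same rigid level
stabilizers, and H, which is always level-transitive, is branch (`IsBranch.of_sect`).

If H is branch, then, as H is closed and self-replicating, the sections of its rigid stabilizers of
letters form closed subgroups of finite index. These contain a level stabilizer of H, and a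
level-by-level correction shows that H is of finite type (`isOfFiniteType_of_level_le`). If H has
depth D and g ∈ G satisfies π_D(g) ∈ π_D(H), the congruence puts every π_D(g|_v) in π_D(H), whence g
∈ H (`mem_of_truncHom_mem`). So the index of H in G is already seen at depth D; it is finite, and G
inherits branchness from H.

On the field side, Gal(Ω/K(t)) maps onto Gal(K^sep/K), and for a homomorphism q the index of q(H) in
q(G) is the degree of the constants of the field cut out by q (`finrank_inf_separableClosure`).
Taking q to be the identity and π_D gives two nested constant fields of the same finite degree. -/

theorem truncHom_eq_iff {n : ℕ} {g h : TreeAut X} :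
    truncHom X n g = truncHom X n h ↔ ∀ w : List X, w.length ≤ n → g w = h w := by
  constructor
  · intro e w hw
    exact congrArg Subtype.val (DFunLike.congr_fun e (⟨w, hw⟩ : {w : List X // w.length ≤ n}))
  · intro e
    ext1 w
    exact Subtype.ext (e w.1 w.2)

theorem truncHom_eq_one_iff {n : ℕ} {g : TreeAut X} :
    truncHom X n g = 1 ↔ ∀ w : List X, w.length ≤ n → g w = w := by
  rw [← map_one (truncHom X n), truncHom_eq_iff]
  rfl

theorem truncHom_eq_of_le {m n : ℕ} (hmn : m ≤ n) {g h : TreeAut X}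
    (e : truncHom X n g = truncHom X n h) : truncHom X m g = truncHom X m h :=
  truncHom_eq_iff.2 fun w hw => truncHom_eq_iff.1 e w (hw.trans hmn)

theorem TreeAut.apply_nil (g : TreeAut X) : g [] = [] :=
  List.length_eq_zero_iff.1 (g.length_apply [])

theorem TreeAut.sect_nil (g : TreeAut X) : g.sect [] = g := by
  ext1 w
  have h := g.apply_append_sect [] w
  rw [g.apply_nil] at h
  exact h.symm

theorem TreeAut.sect_append (g : TreeAut X) (u v : List X) :
    g.sect (u ++ v) = (g.sect u).sect v := by
  ext1 w
  apply List.append_cancel_left (as := g (u ++ v))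
  rw [← g.apply_append_sect, List.append_assoc, g.apply_append_sect, g.apply_append_sect,
    (g.sect u).apply_append_sect, List.append_assoc]

theorem TreeAut.ext_cons {g h : TreeAut X} (e : ∀ x w, g (x :: w) = h (x :: w)) : g = h := by
  ext1 w
  cases w with
  | nil => rw [g.apply_nil, h.apply_nil]
  | cons x w => exact e x w

instance [Finite X] (n : ℕ) : Finite (TruncAut X n) := by
  have : Finite {w : List X // w.length ≤ n} := List.finite_length_le X n
  exact DFunLike.finite _

/-- The tree automorphism that fixes the first level and has the given sections there. -/
def ofSections : (X → TreeAut X) →* TreeAut X where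
  toFun h :=
    { toFun := fun w => match w with
        | [] => []
        | x :: w => x :: h x w
      invFun := fun w => match w with
        | [] => []
        | x :: w => x :: (h x)⁻¹ w
      left_inv := by
        rintro (_ | ⟨x, w⟩)
        · rfl
        · exact congrArg (x :: ·) ((h x).inv_apply w)
      right_inv := by
        rintro (_ | ⟨x, w⟩)
        · rfl
        · exact congrArg (x :: ·) ((h x).apply_inv w)
      map_rel_iff' := by
        rintro (_ | ⟨x, u⟩) (_ | ⟨y, v⟩)
        · simp
        · simp
        · simp
        · simp only [Equiv.coe_fn_mk, List.cons_prefix_cons]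
          refine and_congr_right ?_
          rintro rfl
          exact (h x).prefix_iff }
  map_one' := TreeAut.ext_cons fun _ _ => rfl
  map_mul' _ _ := TreeAut.ext_cons fun _ _ => rfl

theorem ofSections_cons (h : X → TreeAut X) (x : X) (w : List X) :
    ofSections h (x :: w) = x :: h x w :=
  rfl

theorem TreeAut.apply_cons_of_fixed {g : TreeAut X} {x : X} (h : g [x] = [x]) (w : List X) :
    g (x :: w) = x :: g.sect [x] w := by
  have := g.apply_append_sect [x] w
  rwa [h] at this

theorem sect_ofSections (h : X → TreeAut X) (x : X) : (ofSections h).sect [x] = h x := by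
  ext1 w
  have h1 := TreeAut.apply_cons_of_fixed (g := ofSections h) (x := x)
    (by rw [ofSections_cons, TreeAut.apply_nil]) w
  rw [ofSections_cons] at h1
  exact (List.cons_injective h1).symm

theorem eq_ofSections {g : TreeAut X} (hg : ∀ x : X, g [x] = [x]) :
    g = ofSections fun x => g.sect [x] :=
  TreeAut.ext_cons fun x w => by rw [ofSections_cons, TreeAut.apply_cons_of_fixed (hg x)]

/-- The subgroup is closed for the topology of pointwise convergence on the levels. -/
def IsLevelClosed (G : Subgroup (TreeAut X)) : Prop :=
  ∀ g : TreeAut X, (∀ n : ℕ, truncHom X n g ∈ G.map (truncHom X n)) → g ∈ G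

/-- The sections of elements of `G` at letters lie in `G`, and each element of `G` is a section of
an element of the stabilizer of any given letter. -/
structure IsSelfReplicating (G : Subgroup (TreeAut X)) : Prop where
  sect_mem : ∀ g ∈ G, ∀ x : X, g.sect [x] ∈ G
  exists_sect : ∀ g ∈ G, ∀ x : X, ∃ h ∈ G, h [x] = [x] ∧ h.sect [x] = g

theorem IsSelfReplicating.sect_mem' {G : Subgroup (TreeAut X)} (hG : IsSelfReplicating G)
    {g : TreeAut X} (hg : g ∈ G) (v : List X) : g.sect v ∈ G := by
  induction v generalizing g with
  | nil => rwa [TreeAut.sect_nil]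
  | cons x v ih =>
    rw [← List.singleton_append, TreeAut.sect_append]
    exact ih (hG.sect_mem g hg x)

/-- A level-closed subgroup of finite relative index in `G` contains a level stabilizer
of `G`. -/
theorem exists_level_le_of_relIndex_ne_zero {R G : Subgroup (TreeAut X)} (hR : IsLevelClosed R)
    (hi : R.relIndex G ≠ 0) :
    ∃ m : ℕ, ∀ g ∈ G, truncHom X m g = 1 → g ∈ R := by
  have hfin : Finite (G ⧸ R.subgroupOf G) := by
    rw [← Subgroup.finiteIndex_iff_finite_quotient]
    exact ⟨hi⟩
  have key : ∀ q : G ⧸ R.subgroupOf G, ∃ m : ℕ, ∀ g : G,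
      (QuotientGroup.mk g : G ⧸ R.subgroupOf G) = q → truncHom X m g.1 = 1 → g.1 ∈ R := by
    intro q
    by_contra! hcon
    choose c hc hc1 hcR using hcon
    -- The elements (c 0)⁻¹(c n) lie in R, since all c n lie in one coset, and they converge
    -- levelwise to (c 0)⁻¹.
    have hmem : (c 0).1⁻¹ ∈ R := by
      refine hR _ fun n => ⟨(c 0).1⁻¹ * (c n).1, ?_, ?_⟩
      · have := QuotientGroup.eq.1 ((hc 0).trans (hc n).symm)
        exact Subgroup.mem_subgroupOf.1 this
      · rw [map_mul, hc1, mul_one]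
    exact hcR 0 (R.inv_mem_iff.1 hmem)
  choose m hm using key
  obtain ⟨M, hM⟩ := (Set.finite_range m).bddAbove
  refine ⟨M, fun g hg h1 => hm (QuotientGroup.mk ⟨g, hg⟩) ⟨g, hg⟩ rfl ?_⟩
  rw [← map_one (truncHom X _)] at h1 ⊢
  exact truncHom_eq_of_le (hM ⟨_, rfl⟩) h1

/-- Only the case u = v is not immediate: if g moved v, then g v would not lie below v, so g would
fix g v, against injectivity. -/
theorem rist_fixes {G : Subgroup (TreeAut X)} {v u : List X} {g : TreeAut X} (hg : g ∈ rist G v)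
    (h : u.length ≤ v.length) : g u = u := by
  by_cases hu : v <+: u
  · obtain rfl : v = u := hu.eq_of_length (le_antisymm hu.length_le h)
    by_contra hne
    have h1 : ¬ v <+: g v := fun hp => hne (hp.eq_of_length (g.length_apply _).symm).symm
    exact hne (g.injective (hg.2 _ h1))
  · exact hg.2 u hu

theorem le_finiteTypeGroup {G : Subgroup (TreeAut X)} (hG : IsSelfReplicating G) (D : ℕ) :
    G ≤ finiteTypeGroup (G.map (truncHom X D)) :=
  fun _ hg v => ⟨_, hG.sect_mem' hg v, rfl⟩

theorem sect_mem_finiteTypeGroup {D : ℕ} {P : Subgroup (TruncAut X D)} {g : TreeAut X}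
    (hg : g ∈ finiteTypeGroup P) (v : List X) : g.sect v ∈ finiteTypeGroup P := by
  intro u
  rw [← TreeAut.sect_append]
  exact hg (v ++ u)

/-! ### Rigid stabilizers of letters, and finite type -/

section Rist

variable [DecidableEq X]

/-- The sections at the letter `x` of the elements of the rigid stabilizer of `x`. -/
def ristSections (G : Subgroup (TreeAut X)) (x : X) : Subgroup (TreeAut X) :=
  (G.comap ofSections).comap (MonoidHom.mulSingle (fun _ : X => TreeAut X) x)

theorem mem_ristSections {G : Subgroup (TreeAut X)} {x : X} {k : TreeAut X} :
    k ∈ ristSections G x ↔ ofSections (Pi.mulSingle x k) ∈ G :=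
  Iff.rfl

theorem isLevelClosed_ristSections {G : Subgroup (TreeAut X)} (hG : IsLevelClosed G) (x : X) :
    IsLevelClosed (ristSections G x) := by
  intro k hk
  refine mem_ristSections.2 (hG _ fun n => ?_)
  obtain ⟨h, hh, e⟩ := hk n
  refine ⟨_, mem_ristSections.1 hh, truncHom_eq_iff.2 ?_⟩
  rintro (_ | ⟨y, w⟩) hw
  · rfl
  · rw [ofSections_cons, ofSections_cons]
    by_cases hy : y = x
    · subst hy
      rw [Pi.mulSingle_eq_same, Pi.mulSingle_eq_same,
        truncHom_eq_iff.1 e w (by simp only [List.length_cons] at hw; omega)]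
    · rw [Pi.mulSingle_eq_of_ne hy, Pi.mulSingle_eq_of_ne hy]

/-- The conclusion cuts out a subgroup U, so it suffices to check it on the rigid stabilizers of
single letters, where at most one first-level section is nontrivial. -/
theorem sect_mem_ristSections_of_mem_levelRist {G : Subgroup (TreeAut X)} {g : TreeAut X}
    (hg : g ∈ levelRist G 1) (x : X) : g [x] = [x] ∧ g.sect [x] ∈ ristSections G x := by
  let U : Subgroup (TreeAut X) :=
    { carrier := {g | g [x] = [x] ∧ g.sect [x] ∈ ristSections G x}
      one_mem' := ⟨rfl, by rw [TreeAut.sect_one]; exact one_mem _⟩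
      mul_mem' := by
        rintro a b ⟨ha, ha'⟩ ⟨hb, hb'⟩
        refine ⟨?_, ?_⟩
        · change a (b [x]) = [x]
          rw [hb, ha]
        · rw [TreeAut.sect_mul, hb]
          exact mul_mem ha' hb'
      inv_mem' := by
        rintro a ⟨ha, ha'⟩
        have h1 : a⁻¹ [x] = [x] := a.injective (by rw [a.apply_inv, ha])
        refine ⟨h1, ?_⟩
        rw [TreeAut.sect_inv, h1]
        exact inv_mem ha' }
  have hU : levelRist G 1 ≤ U := by
    refine iSup_le ?_
    rintro ⟨v, hv⟩ a ha
    obtain ⟨y, rfl⟩ := List.length_eq_one_iff.1 hv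
    have hfix : ∀ z : X, a [z] = [z] := fun z => rist_fixes ha le_rfl
    have hsect : ∀ z : X, z ≠ y → a.sect [z] = 1 := by
      intro z hz
      ext1 w
      apply List.append_cancel_left (as := a [z])
      rw [← a.apply_append_sect, hfix z]
      refine ha.2 _ ?_
      rw [List.singleton_append, List.cons_prefix_cons]
      exact fun h => hz h.1.symm
    refine ⟨hfix x, ?_⟩
    by_cases hx : x = y
    · subst hx
      rw [mem_ristSections]
      convert ha.1 using 1
      rw [eq_ofSections hfix]
      congr 1
      funext z
      by_cases hz : z = x
      · subst hz
        rw [Pi.mulSingle_eq_same, sect_ofSections]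
      · rw [Pi.mulSingle_eq_of_ne hz, hsect z hz]
    · rw [hsect x hx]
      exact one_mem _
  exact hU hg

/-- The stabilizer of the letter `x`. -/
def letterStab (x : X) : Subgroup (TreeAut X) where
  carrier := {g | g [x] = [x]}
  one_mem' := rfl
  mul_mem' := by
    rintro a b (ha : a [x] = [x]) (hb : b [x] = [x])
    change a (b [x]) = [x]
    rw [hb, ha]
  inv_mem' := by
    rintro a (ha : a [x] = [x])
    exact a.injective (by rw [a.apply_inv, ha])

/-- The section at `x`, as a homomorphism on the stabilizer of `x`. -/
def letterSect (x : X) : letterStab x →* TreeAut X where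
  toFun g := g.1.sect [x]
  map_one' := TreeAut.sect_one _
  map_mul' a b := by
    have hb : b.1 [x] = [x] := b.2
    change (a.1 * b.1).sect [x] = _
    rw [TreeAut.sect_mul, hb]

/-- By self-replication the section at x maps the stabilizer of x in G onto a group containing G.
The preimage of `ristSections G x` contains the part of the rigid level stabilizer in G, hence has
finite index. -/
theorem relIndex_ristSections_ne_zero {G : Subgroup (TreeAut X)} (hG : IsSelfReplicating G)
    (h : ((levelRist G 1).subgroupOf G).FiniteIndex) (x : X) :
    (ristSections G x).relIndex G ≠ 0 := by
  let s := (letterSect x).comp (Subgroup.inclusion (inf_le_right : G ⊓ letterStab x ≤ letterStab x))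
  have h1 : G ≤ s.range := by
    intro g hg
    obtain ⟨k, hk, hkx, rfl⟩ := hG.exists_sect g hg x
    exact ⟨⟨k, hk, hkx⟩, rfl⟩
  have h2 : (levelRist G 1).subgroupOf (G ⊓ letterStab x) ≤ (ristSections G x).comap s :=
    fun k hk => (sect_mem_ristSections_of_mem_levelRist (Subgroup.mem_subgroupOf.1 hk) x).2
  have h3 : (levelRist G 1).relIndex (G ⊓ letterStab x) ≠ 0 := fun h0 =>
    h.index_ne_zero (Subgroup.relIndex_eq_zero_of_le_right inf_le_left h0)
  have h4 : ((ristSections G x).comap s).index ≠ 0 := by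
    have : ((levelRist G 1).subgroupOf (G ⊓ letterStab x)).FiniteIndex := ⟨h3⟩
    exact (Subgroup.finiteIndex_of_le h2).index_ne_zero
  rw [Subgroup.index_comap] at h4
  exact fun h0 => h4 (Subgroup.relIndex_eq_zero_of_le_right h1 h0)

/-- If a level stabilizer of `G`, placed below any letter, lies in `G`, then `G` is of
finite type. -/
theorem isOfFiniteType_of_level_le [Finite X] {G : Subgroup (TreeAut X)}
    (hG : IsSelfReplicating G) (hc : IsLevelClosed G) {m : ℕ}
    (hm : ∀ x, ∀ g ∈ G, truncHom X m g = 1 → g ∈ ristSections G x) :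
    IsOfFiniteType G (m + 1) := by
  refine ⟨by omega, G.map (truncHom X (m + 1)), le_antisymm (le_finiteTypeGroup hG _) ?_⟩
  suffices key : ∀ n : ℕ, ∀ g ∈ finiteTypeGroup (G.map (truncHom X (m + 1))),
      truncHom X n g ∈ G.map (truncHom X n) from fun g hg => hc g fun n => key n g hg
  intro n
  induction n with
  | zero =>
    intro g _
    refine ⟨1, one_mem _, truncHom_eq_iff.2 fun w hw => ?_⟩
    obtain rfl := List.length_eq_zero_iff.1 (Nat.le_zero.1 hw)
    rw [g.apply_nil, TreeAut.apply_nil]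
  | succ k ih =>
    intro g hg
    -- Up to depth m + 1 the pattern at the root suffices. Beyond it k ≥ m + 1, so an element
    -- trivial to depth k has first-level sections trivial to depth k - 1 ≥ m, as the hypothesis
    -- requires.
    by_cases hk : k + 1 ≤ m + 1
    · obtain ⟨h, hh, e⟩ := hg []
      rw [TreeAut.sect_nil] at e
      exact ⟨h, hh, truncHom_eq_of_le hk e⟩
    obtain ⟨h, hh, e⟩ := ih g hg
    have hg' : h⁻¹ * g ∈ finiteTypeGroup (G.map (truncHom X (m + 1))) :=
      mul_mem (inv_mem (le_finiteTypeGroup hG _ hh)) hg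
    have htriv : ∀ w : List X, w.length ≤ k → (h⁻¹ * g) w = w := by
      rw [← truncHom_eq_one_iff, map_mul, map_inv, e, inv_mul_cancel]
    set a := h⁻¹ * g with ha
    have hfix : ∀ x : X, a [x] = [x] := fun x => htriv _ (by simp only [List.length_singleton]; omega)
    -- The sections of a again lie in the finite type group, so induction approximates them to depth
    -- k by elements of G; glued below the letters, these match a to depth k + 1.
    choose b hb eb using fun x : X => ih _ (sect_mem_finiteTypeGroup hg' [x])
    have hbR : ∀ x, b x ∈ ristSections G x := by
      intro x
      refine hm x _ (hb x) (truncHom_eq_one_iff.2 fun w hw => ?_)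
      rw [truncHom_eq_iff.1 (eb x) w (by omega)]
      have h1 := htriv (x :: w) (by simp only [List.length_cons]; omega)
      rw [TreeAut.apply_cons_of_fixed (hfix x)] at h1
      exact List.cons_injective h1
    have hbG : ofSections b ∈ G :=
      Subgroup.pi_mem_of_mulSingle_mem (H := G.comap ofSections) b fun x => mem_ristSections.1 (hbR x)
    refine ⟨h * ofSections b, mul_mem hh hbG, ?_⟩
    have : g = h * a := by rw [ha, mul_inv_cancel_left]
    rw [this, map_mul, map_mul]
    congr 1
    refine truncHom_eq_iff.2 ?_
    rintro (_ | ⟨x, w⟩) hw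
    · rw [TreeAut.apply_nil, TreeAut.apply_nil]
    · rw [ofSections_cons, TreeAut.apply_cons_of_fixed (hfix x),
        truncHom_eq_iff.1 (eb x) w (by simp only [List.length_cons] at hw; omega)]

/-- A level-closed self-replicating branch group is of finite type. -/
theorem IsBranch.exists_isOfFiniteType [Finite X] {G : Subgroup (TreeAut X)} (hb : IsBranch G)
    (hG : IsSelfReplicating G) (hc : IsLevelClosed G) : ∃ D : ℕ, IsOfFiniteType G D := by
  choose m hm using fun x => exists_level_le_of_relIndex_ne_zero
    (isLevelClosed_ristSections hc x)
    (relIndex_ristSections_ne_zero hG (hb.2 1 le_rfl) x)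
  obtain ⟨M, hM⟩ := (Set.finite_range m).bddAbove
  refine ⟨M + 1, isOfFiniteType_of_level_le hG hc fun x g hg h1 => hm x g hg ?_⟩
  rw [← map_one (truncHom X _)] at h1 ⊢
  exact truncHom_eq_of_le (hM ⟨x, rfl⟩) h1

end Rist

/-! ### Pairs H ≤ G whose sections preserve classes modulo H -/

section Pair

variable {G H : Subgroup (TreeAut X)}

/-- If sections do not change the class modulo `H`, and `H` is of finite type of depth `D`, then
membership in `H` can be tested on the truncated tree of depth `D`. -/
theorem mem_of_truncHom_mem {D : ℕ} (hD : IsOfFiniteType H D)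
    (hs : ∀ g ∈ G, ∀ v, g⁻¹ * g.sect v ∈ H) {g : TreeAut X}
    (hg : g ∈ G) (h : truncHom X D g ∈ H.map (truncHom X D)) : g ∈ H := by
  obtain ⟨-, P, hP⟩ := hD
  -- The defining group of patterns may be replaced by π_D(H), which it contains: look at sections
  -- at the root.
  have hle : finiteTypeGroup (H.map (truncHom X D)) ≤ H := by
    intro k hk
    rw [hP]
    intro v
    obtain ⟨a, ha, e⟩ := hk v
    rw [← e]
    rw [SetLike.mem_coe, hP] at ha
    simpa only [TreeAut.sect_nil] using ha []
  refine hle fun v => ?_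
  rw [← mul_inv_cancel_left g (g.sect v), map_mul]
  exact mul_mem h ⟨_, hs g hg v, rfl⟩

/-- By the membership test, H is the full preimage in G of π_D(H). -/
theorem relIndex_map_truncHom {D : ℕ} (hD : IsOfFiniteType H D)
    (hs : ∀ g ∈ G, ∀ v, g⁻¹ * g.sect v ∈ H) :
    H.relIndex G = (H.map (truncHom X D)).relIndex (G.map (truncHom X D)) := by
  have h1 := Subgroup.index_comap (H.map (truncHom X D)) ((truncHom X D).comp G.subtype)
  have h2 : ((truncHom X D).comp G.subtype).range = G.map (truncHom X D) := by
    rw [MonoidHom.range_comp, Subgroup.range_subtype]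
  rw [h2] at h1
  rw [← h1, Subgroup.relIndex]
  congr 1
  ext g
  rw [Subgroup.mem_subgroupOf]
  exact ⟨fun h => ⟨_, h, rfl⟩, fun h => mem_of_truncHom_mem hD hs g.2 h⟩

theorem relIndex_ne_zero_of_isOfFiniteType [Finite X] {D : ℕ} (hD : IsOfFiniteType H D)
    (hs : ∀ g ∈ G, ∀ v, g⁻¹ * g.sect v ∈ H) :
    H.relIndex G ≠ 0 := by
  rw [relIndex_map_truncHom hD hs]
  exact Subgroup.FiniteIndex.index_ne_zero

theorem rist_mono (hHG : H ≤ G) (v : List X) : rist H v ≤ rist G v :=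
  fun _ hg => ⟨hHG hg.1, hg.2⟩

theorem levelRist_mono (hHG : H ≤ G) (n : ℕ) : levelRist H n ≤ levelRist G n :=
  iSup_mono fun v => rist_mono hHG v.1

theorem IsLevelTransitive.mono (hHG : H ≤ G) (h : IsLevelTransitive H) : IsLevelTransitive G := by
  intro u v huv
  obtain ⟨g, hg, e⟩ := h u v huv
  exact ⟨g, hHG hg, e⟩

theorem IsBranch.of_relIndex_ne_zero (hb : IsBranch H) (hHG : H ≤ G) (h : H.relIndex G ≠ 0) :
    IsBranch G := by
  refine ⟨hb.1.mono hHG, fun n hn => ⟨fun h0 => ?_⟩⟩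
  have h1 : (levelRist H n).relIndex H ≠ 0 := (hb.2 n hn).index_ne_zero
  exact Subgroup.relIndex_ne_zero_trans h1 h
    (Subgroup.relIndex_eq_zero_of_le_left (levelRist_mono hHG n) h0)

/-- At a letter y different from the first letter of v the section is trivial, so g is congruent to
1 modulo H. This is where two letters are needed. -/
theorem rist_le_of_sect [Nontrivial X] (hs : ∀ g ∈ G, ∀ v, g⁻¹ * g.sect v ∈ H) {v : List X}
    (hv : 1 ≤ v.length) : rist G v ≤ H := by
  rintro g ⟨hg, hg'⟩
  obtain ⟨x, v, rfl⟩ := List.exists_cons_of_length_pos hv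
  obtain ⟨y, hy⟩ := exists_ne x
  have hnot : ∀ w, ¬ (x :: v) <+: y :: w := fun w h => hy (List.cons_prefix_cons.1 h).1.symm
  have h1 : g.sect [y] = 1 := by
    ext1 w
    apply List.append_cancel_left (as := g [y])
    rw [← g.apply_append_sect, hg' [y] (hnot _)]
    exact hg' _ (hnot w)
  have h2 := hs g hg [y]
  rw [h1, mul_one] at h2
  exact H.inv_mem_iff.1 h2

theorem IsBranch.of_sect [Nontrivial X] (hb : IsBranch G) (hHG : H ≤ G)
    (ht : IsLevelTransitive H) (hs : ∀ g ∈ G, ∀ v, g⁻¹ * g.sect v ∈ H) : IsBranch H := by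
  refine ⟨ht, fun n hn => ⟨fun h0 => ?_⟩⟩
  have hle : levelRist G n ≤ levelRist H n := by
    refine iSup_mono fun v g hg => ⟨?_, hg.2⟩
    exact rist_le_of_sect hs (hn.trans v.2.ge) hg
  exact (hb.2 n hn).index_ne_zero
    (Subgroup.relIndex_eq_zero_of_le_left hle (Subgroup.relIndex_eq_zero_of_le_right hHG h0))

end Pair

end Tree

/-! ### Infinite Galois theory inside Ω -/

section FieldTheory

variable {K Ω : Type*} [Field K] [Field Ω] [Algebra K Ω]

theorem mem_fixingSubgroup_adjoin {s : Set Ω} {σ : Ω ≃ₐ[K] Ω} :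
    σ ∈ (IntermediateField.adjoin K s).fixingSubgroup ↔ ∀ x ∈ s, σ x = x := by
  -- Passing to the cyclic group generated by σ makes the Galois connection applicable, which
  -- reduces the claim to generators of the field.
  rw [← Subgroup.zpowers_le, ← IntermediateField.le_iff_le, IntermediateField.adjoin_le_iff]
  refine forall₂_congr fun x _ => ?_
  rw [SetLike.mem_coe, IntermediateField.mem_fixedField_iff]
  refine ⟨fun h => h σ (Subgroup.mem_zpowers σ), fun h τ hτ => ?_⟩
  have : Subgroup.zpowers σ ≤ MulAction.stabilizer (Ω ≃ₐ[K] Ω) x := by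
    rw [Subgroup.zpowers_le]
    exact h
  exact this hτ

theorem mem_galOver {t : Ω} {L : IntermediateField K Ω} {σ : Ω ≃ₐ[K] Ω} :
    σ ∈ galOver t L ↔ (∀ x ∈ L, σ x = x) ∧ σ t = t := by
  rw [galOver, mem_fixingSubgroup_adjoin]
  constructor
  · exact fun h => ⟨fun x hx => h x (Or.inl hx), h t (Or.inr rfl)⟩
  · rintro ⟨h1, h2⟩ x (hx | rfl)
    · exact h1 x hx
    · exact h2

theorem mem_galOver_bot {t : Ω} {σ : Ω ≃ₐ[K] Ω} :
    σ ∈ galOver t (⊥ : IntermediateField K Ω) ↔ σ t = t := by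
  rw [mem_galOver, and_iff_right_iff_imp]
  rintro - x hx
  obtain ⟨a, rfl⟩ := IntermediateField.mem_bot.1 hx
  exact σ.commutes a

theorem apply_mem_separableClosure (σ : Ω ≃ₐ[K] Ω) {x : Ω} (hx : x ∈ separableClosure K Ω) :
    σ x ∈ separableClosure K Ω := by
  rw [mem_separableClosure_iff] at hx ⊢
  exact IsSeparable.map σ.toAlgHom σ.injective hx

/-- Rational functions in a transcendental element that are algebraic are constant. -/
theorem mem_bot_of_mem_adjoin_transcendental {t : Ω} (ht : Transcendental K t) {x : Ω}
    (hx : x ∈ IntermediateField.adjoin K {t}) (ha : IsAlgebraic K x) :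
    x ∈ (⊥ : IntermediateField K Ω) := by
  let e := RatFunc.algEquivOfTranscendental t ht
  have hval : IsAlgebraic K (e.symm ⟨x, hx⟩) := by
    have h1 : IsAlgebraic K (⟨x, hx⟩ : IntermediateField.adjoin K {t}) :=
      (isAlgebraic_algHom_iff (IntermediateField.val _) Subtype.val_injective).1 ha
    exact h1.algHom e.symm.toAlgHom
  by_contra hne
  refine RatFunc.transcendental_of_ne_C (e.symm ⟨x, hx⟩) ?_ hval
  rintro ⟨c, hc⟩
  rw [AlgEquiv.symm_apply_eq, ← RatFunc.algebraMap_eq_C, AlgEquiv.commutes] at hc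
  exact hne (IntermediateField.mem_bot.2 ⟨c, (congrArg Subtype.val hc).symm⟩)

theorem isGalois_of_mem {t : Ω} (hΩ : IsSepClosure (IntermediateField.adjoin K {t}) Ω)
    {M : IntermediateField K Ω} (ht : t ∈ M) : IsGalois M Ω := by
  have hle : IntermediateField.adjoin K {t} ≤ M := by
    rw [IntermediateField.adjoin_le_iff, Set.singleton_subset_iff]
    exact ht
  let := (IntermediateField.inclusion hle).toRingHom.toAlgebra
  have : IsScalarTower (IntermediateField.adjoin K {t}) M Ω :=
    IsScalarTower.of_algebraMap_eq fun _ => rfl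
  exact IsGalois.tower_top_of_isGalois (IntermediateField.adjoin K {t}) M Ω

/-- The set is empty or a coset of the stabilizer of x, which is open and therefore closed. -/
theorem isClosed_setOf_apply_eq {k E : Type*} [Field k] [Field E] [Algebra k E] [IsGalois k E]
    (x y : E) : IsClosed {σ : E ≃ₐ[k] E | σ x = y} := by
  by_cases h : ∃ σ₀ : E ≃ₐ[k] E, σ₀ x = y
  · obtain ⟨σ₀, rfl⟩ := h
    have h1 := (Subgroup.isClosed_of_isOpen _
      (stabilizer_isOpen_of_isIntegral (K := k) (L := E) x)).preimage (continuous_const_mul σ₀⁻¹)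
    convert h1 using 1
    ext σ
    change σ x = σ₀ x ↔ σ₀⁻¹ (σ x) = x
    constructor
    · intro e
      rw [e]
      exact σ₀.symm_apply_apply x
    · intro e
      nth_rw 2 [← e]
      exact (σ₀.apply_symm_apply _).symm
  · convert isClosed_empty
    ext σ
    exact ⟨fun e => h ⟨σ, e⟩, False.elim⟩

/-- If `Ω / M` is Galois and `S / K` is Galois, where `M` and `S` are intermediate fields of
`Ω / K`, then the restrictions to `S` of the automorphisms of `Ω` over `M` are the automorphisms
of `S` over `M ∩ S`. -/
theorem map_restrictNormalHom_fixingSubgroup (S M : IntermediateField K Ω) [IsGalois K S]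
    [IsGalois M Ω] :
    M.fixingSubgroup.map (AlgEquiv.restrictNormalHom S) =
      (IntermediateField.restrict (inf_le_right : M ⊓ S ≤ S)).fixingSubgroup := by
  let ρ : (Ω ≃ₐ[M] Ω) →* (S ≃ₐ[K] S) :=
    (AlgEquiv.restrictNormalHom S).comp
      (M.fixingSubgroup.subtype.comp (IntermediateField.fixingSubgroupEquiv M).symm.toMonoidHom)
  have hρ : ∀ (σ : Ω ≃ₐ[M] Ω) (x : S), (ρ σ x : Ω) = σ x := fun σ x =>
    AlgEquiv.restrictNormal_commutes (σ.restrictScalars K) S x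
  have hrange : M.fixingSubgroup.map (AlgEquiv.restrictNormalHom S) = ρ.range := by
    rw [MonoidHom.range_comp, MonoidHom.range_comp]
    congr 1
    rw [MonoidHom.range_eq_top.2 (IntermediateField.fixingSubgroupEquiv M).symm.surjective,
      ← MonoidHom.range_eq_map, Subgroup.range_subtype]
  -- Fixing a finite extension E pointwise means fixing a finite basis of it, which is an open
  -- condition in Gal(Ω/M).
  have hcont : Continuous ρ := by
    refine continuous_of_continuousAt_one ρ fun U hU => ?_
    rw [map_one, krullTopology_mem_nhds_one_iff] at hU
    obtain ⟨E, hE, hEU⟩ := hU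
    let b := Module.finBasis K E
    have hopen : IsOpen (⋂ i, (MulAction.stabilizer (Ω ≃ₐ[M] Ω) ((b i : S) : Ω) : Set (Ω ≃ₐ[M] Ω))) :=
      isOpen_iInter_of_finite fun i => stabilizer_isOpen_of_isIntegral (K := M) (L := Ω) _
    refine Filter.mem_map.2 <| Filter.mem_of_superset
      (hopen.mem_nhds (Set.mem_iInter.2 fun i => one_mem _)) fun σ hσ => hEU ?_
    rw [Set.mem_iInter] at hσ
    have hlin : (ρ σ).toLinearMap ∘ₗ E.val.toLinearMap = E.val.toLinearMap :=
      b.ext fun i => Subtype.ext ((hρ σ _).trans (hσ i))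
    exact fun x => LinearMap.congr_fun hlin x
  -- The image is compact, hence closed, so it is determined by its fixed field; that field is M ∩ S
  -- because Ω/M is Galois.
  have hclosed : IsClosed (ρ.range : Set (S ≃ₐ[K] S)) := by
    rw [MonoidHom.coe_range]
    exact (isCompact_range hcont).isClosed
  have hfix := InfiniteGalois.fixingSubgroup_fixedField (⟨ρ.range, hclosed⟩ : ClosedSubgroup _)
  rw [hrange]
  refine hfix.symm.trans ?_
  congr 1
  ext x
  rw [IntermediateField.mem_fixedField_iff, IntermediateField.mem_restrict,
    IntermediateField.mem_inf, and_iff_left x.2]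
  constructor
  · intro h
    have h1 : (x : Ω) ∈ Set.range (algebraMap M Ω) := by
      rw [InfiniteGalois.mem_range_algebraMap_iff_fixed]
      intro σ
      rw [← hρ, h (ρ σ) ⟨σ, rfl⟩]
    obtain ⟨y, hy⟩ := h1
    rw [← hy]
    exact y.2
  · rintro h _ ⟨σ, rfl⟩
    apply Subtype.ext
    rw [hρ]
    exact σ.commutes ⟨x, h⟩

end FieldTheory

/-- Both sides are the index in A of the join of the two kernels. -/
theorem relIndex_map_ker {A B C : Type*} [Group A] [Group B] [Group C] (r : A →* B) (φ : A →* C)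
    (hφ : Function.Surjective φ) : (φ.ker.map r).relIndex r.range = (r.ker.map φ).index := by
  rw [← Subgroup.index_comap, Subgroup.comap_map_eq,
    ← Subgroup.index_comap_of_surjective _ hφ, Subgroup.comap_map_eq, sup_comm]

/-! ### Lifting sections and tree actions to Galois automorphisms -/

namespace PathSystem

variable {K Ω : Type*} [Field K] [Field Ω] [Algebra K Ω] {f : RatFunc K} {t : Ω}
  (P : PathSystem f t)

theorem vertex_rep (L : IntermediateField K Ω) (σ : galOver t L) (w : List (Fin (ratDegree f))) :
    P.vertex (P.rep L σ w) = σ.1 (P.vertex w) := by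
  have h : P.label (P.rep L σ w) = arborealRep f t L σ (P.label w) :=
    P.label.apply_symm_apply _
  exact congrArg (fun z : PreimageTree f t => z.2.1) h

theorem eq_rep_iff {L : IntermediateField K Ω} {σ : galOver t L}
    {g : TreeAut (Fin (ratDegree f))} :
    P.rep L σ = g ↔ ∀ w, P.vertex (g w) = σ.1 (P.vertex w) := by
  constructor
  · rintro rfl w
    exact P.vertex_rep L σ w
  · intro h
    ext1 w
    apply P.vertex_injective
    · rw [TreeAut.length_apply, TreeAut.length_apply]
    · rw [h, vertex_rep]

theorem mem_iteratedGaloisGroup {L : IntermediateField K Ω} {g : TreeAut (Fin (ratDegree f))} :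
    g ∈ P.iteratedGaloisGroup L ↔
      ∃ σ ∈ galOver t L, ∀ w, P.vertex (g w) = σ (P.vertex w) := by
  constructor
  · rintro ⟨σ, rfl⟩
    exact ⟨σ.1, σ.2, P.vertex_rep L σ⟩
  · rintro ⟨σ, hσ, h⟩
    exact ⟨⟨σ, hσ⟩, P.eq_rep_iff.2 h⟩

/-- A path, as an automorphism over `K`. -/
def pathAut (i : Fin (ratDegree f)) : Ω ≃ₐ[K] Ω :=
  (P.path i).restrictScalars K

theorem pathAut_of_mem (i : Fin (ratDegree f)) {x : Ω} (hx : x ∈ separableClosure K Ω) :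
    P.pathAut i x = x :=
  (P.path i).commutes ⟨x, hx⟩

theorem pathAut_inv_of_mem (i : Fin (ratDegree f)) {x : Ω} (hx : x ∈ separableClosure K Ω) :
    (P.pathAut i)⁻¹ x = x :=
  (P.path i).symm.commutes ⟨x, hx⟩

theorem inv_apply_self (σ : Ω ≃ₐ[K] Ω) (x : Ω) : σ⁻¹ (σ x) = x :=
  σ.symm_apply_apply x

theorem vertex_cons (i : Fin (ratDegree f)) (w : List (Fin (ratDegree f))) :
    P.vertex (i :: w) = P.pathAut i (P.vertex w) :=
  rfl

theorem vertex_nil : P.vertex [] = t :=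
  rfl

theorem evalRat_pathAut (i : Fin (ratDegree f)) : evalRat f (P.pathAut i t) = t :=
  P.evalRat_path i

/-- Take j with g(i) = j and cancel λ_j in λ_j(vertex of g|_i(w)) = σ(λ_i(vertex of w)). The empty
word shows that the lift fixes t. -/
theorem exists_sect_lift {σ : Ω ≃ₐ[K] Ω} {g : TreeAut (Fin (ratDegree f))}
    (h : ∀ w, P.vertex (g w) = σ (P.vertex w)) (i : Fin (ratDegree f)) :
    ∃ j, ((P.pathAut j)⁻¹ * σ * P.pathAut i) t = t ∧ ∀ w, P.vertex (g.sect [i] w) =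
      ((P.pathAut j)⁻¹ * σ * P.pathAut i) (P.vertex w) := by
  obtain ⟨j, hj⟩ := List.length_eq_one_iff.1 (g.length_apply [i])
  have key : ∀ w, P.vertex (g.sect [i] w) =
      ((P.pathAut j)⁻¹ * σ * P.pathAut i) (P.vertex w) := by
    intro w
    have h1 := g.apply_append_sect [i] w
    rw [hj] at h1
    have h2 := h (i :: w)
    change P.vertex (g ([i] ++ w)) = _ at h2
    rw [h1] at h2
    change P.pathAut j (P.vertex (g.sect [i] w)) = σ (P.pathAut i (P.vertex w)) at h2
    change _ = (P.pathAut j)⁻¹ (σ (P.pathAut i (P.vertex w)))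
    rw [← h2, inv_apply_self]
  refine ⟨j, ?_, key⟩
  have := key []
  rw [TreeAut.apply_nil, vertex_nil] at this
  exact this.symm

theorem isSelfReplicating {L : IntermediateField K Ω} (hL : L ≤ separableClosure K Ω) :
    IsSelfReplicating (P.iteratedGaloisGroup L) := by
  constructor
  · intro g hg i
    obtain ⟨σ, hσ, h⟩ := P.mem_iteratedGaloisGroup.1 hg
    obtain ⟨j, hj, h'⟩ := P.exists_sect_lift h i
    refine P.mem_iteratedGaloisGroup.2 ⟨_, mem_galOver.2 ⟨fun x hx => ?_, hj⟩, h'⟩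
    change (P.pathAut j)⁻¹ (σ (P.pathAut i x)) = x
    rw [P.pathAut_of_mem i (hL hx), (mem_galOver.1 hσ).1 x hx, P.pathAut_inv_of_mem j (hL hx)]
  · intro g hg i
    obtain ⟨σ, hσ, h⟩ := P.mem_iteratedGaloisGroup.1 hg
    have happ : ∀ x, (P.pathAut i * σ * (P.pathAut i)⁻¹) (P.pathAut i x) = P.pathAut i (σ x) := by
      intro x
      change P.pathAut i (σ ((P.pathAut i)⁻¹ (P.pathAut i x))) = _
      rw [inv_apply_self]
    have hmem : P.pathAut i * σ * (P.pathAut i)⁻¹ ∈ galOver t L := by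
      refine mem_galOver.2 ⟨fun x hx => ?_, ?_⟩
      · change P.pathAut i (σ ((P.pathAut i)⁻¹ x)) = x
        rw [P.pathAut_inv_of_mem i (hL hx), (mem_galOver.1 hσ).1 x hx, P.pathAut_of_mem i (hL hx)]
      -- The conjugate fixes λ_i(t), hence also its image t under f.
      · have h1 := evalRat_algEquiv f (P.pathAut i * σ * (P.pathAut i)⁻¹) (P.pathAut i t)
        rw [happ, (mem_galOver.1 hσ).2, evalRat_pathAut] at h1
        exact h1.symm
    have hrep : ∀ w, P.rep L ⟨_, hmem⟩ (i :: w) = i :: g w := by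
      intro w
      apply P.vertex_injective
      · rw [TreeAut.length_apply, List.length_cons, List.length_cons, TreeAut.length_apply]
      · rw [vertex_rep, vertex_cons, vertex_cons, h]
        exact happ _
    have hfix : P.rep L ⟨_, hmem⟩ [i] = [i] := by rw [hrep, TreeAut.apply_nil]
    refine ⟨P.rep L ⟨_, hmem⟩, ⟨_, rfl⟩, hfix, ?_⟩
    ext1 w
    have h1 := TreeAut.apply_cons_of_fixed hfix w
    rw [hrep] at h1
    exact (List.cons_injective h1).symm

theorem geomGroup_le_arithGroup : P.geomGroup ≤ P.arithGroup := by
  intro g hg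
  obtain ⟨σ, hσ, h⟩ := P.mem_iteratedGaloisGroup.1 hg
  exact P.mem_iteratedGaloisGroup.2 ⟨σ, mem_galOver_bot.2 (mem_galOver.1 hσ).2, h⟩

/-- Sections do not change the class of an element of the arithmetic group modulo the geometric
group, as the paths are trivial on the separable closure of `K`. -/
theorem inv_mul_sect_mem_geomGroup {g : TreeAut (Fin (ratDegree f))} (hg : g ∈ P.arithGroup)
    (v : List (Fin (ratDegree f))) : g⁻¹ * g.sect v ∈ P.geomGroup := by
  induction v generalizing g with
  | nil =>
    rw [TreeAut.sect_nil, inv_mul_cancel]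
    exact one_mem _
  | cons i v ih =>
    have hsect := (P.isSelfReplicating bot_le).sect_mem g hg i
    -- Insert g|_i: the product splits as g⁻¹g|_i times (g|_i)⁻¹(g|_i)|_v, and induction handles the
    -- second factor.
    rw [← List.singleton_append, TreeAut.sect_append, ← mul_one g⁻¹,
      ← mul_inv_cancel (g.sect [i]), ← mul_assoc, mul_assoc]
    refine mul_mem ?_ (ih hsect)
    obtain ⟨σ, hσ, h⟩ := P.mem_iteratedGaloisGroup.1 hg
    obtain ⟨j, hj, h'⟩ := P.exists_sect_lift h i
    have hinv : ∀ w, P.vertex (g⁻¹ w) = σ⁻¹ (P.vertex w) := by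
      intro w
      rw [← inv_apply_self σ (P.vertex (g⁻¹ w)), ← h, TreeAut.apply_inv]
    refine P.mem_iteratedGaloisGroup.2
      ⟨σ⁻¹ * ((P.pathAut j)⁻¹ * σ * P.pathAut i), mem_galOver.2 ⟨fun x hx => ?_, ?_⟩, fun w => ?_⟩
    · change σ⁻¹ ((P.pathAut j)⁻¹ (σ (P.pathAut i x))) = x
      rw [P.pathAut_of_mem i hx, P.pathAut_inv_of_mem j (apply_mem_separableClosure σ hx),
        inv_apply_self]
    · change σ⁻¹ (((P.pathAut j)⁻¹ * σ * P.pathAut i) t) = t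
      rw [hj]
      nth_rw 1 [← (mem_galOver.1 hσ).2]
      exact inv_apply_self σ t
    · change P.vertex (g⁻¹ (g.sect [i] w)) = σ⁻¹ (((P.pathAut j)⁻¹ * σ * P.pathAut i) (P.vertex w))
      rw [hinv, h']

theorem exists_autOver_vertex (u : List (Fin (ratDegree f))) :
    ∃ τ : Ω ≃ₐ[separableClosure K Ω] Ω, τ t = P.vertex u := by
  induction u with
  | nil => exact ⟨1, rfl⟩
  | cons i u ih =>
    obtain ⟨τ, h⟩ := ih
    exact ⟨P.path i * τ, congrArg (P.path i) h⟩

/-- Composites of paths carry t to any vertex, so some automorphism over K^sep carries u to v. It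
fixes t because t is the image of both under the same iterate of f. -/
theorem isLevelTransitive_geomGroup : IsLevelTransitive P.geomGroup := by
  intro u v huv
  obtain ⟨τ, hτ⟩ := P.exists_autOver_vertex u
  obtain ⟨τ', hτ'⟩ := P.exists_autOver_vertex v
  let σ : Ω ≃ₐ[K] Ω := (τ.symm.trans τ').restrictScalars K
  have hσ : σ (P.vertex u) = P.vertex v := by
    change τ' (τ.symm (P.vertex u)) = _
    rw [← hτ, AlgEquiv.symm_apply_apply, hτ']
  have hmem : σ ∈ galOver t (separableClosure K Ω) := by
    refine mem_galOver.2 ⟨fun x hx => (τ.symm.trans τ').commutes ⟨x, hx⟩, ?_⟩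
    nth_rw 1 [← P.iterate_vertex u]
    rw [← iterate_evalRat_algEquiv, hσ, huv, iterate_vertex]
  refine ⟨P.rep _ ⟨σ, hmem⟩, ⟨_, rfl⟩, P.vertex_injective _ _ ?_ ?_⟩
  · rw [TreeAut.length_apply, huv]
  · rw [vertex_rep, hσ]

/-- The lifts of g that are correct to depth n form a decreasing sequence of nonempty closed sets in
a compact Galois group, so some automorphism lifts g at all depths. -/
theorem isLevelClosed (hΩ : IsSepClosure (IntermediateField.adjoin K {t}) Ω)
    (L : IntermediateField K Ω) : IsLevelClosed (P.iteratedGaloisGroup L) := by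
  intro g hg
  set F := IntermediateField.adjoin K ((L : Set Ω) ∪ {t}) with hF
  have hGal : IsGalois F Ω :=
    isGalois_of_mem hΩ (IntermediateField.subset_adjoin K _ (Or.inr rfl))
  let C : ℕ → Set (Ω ≃ₐ[F] Ω) := fun n =>
    {σ | ∀ w, w.length ≤ n → σ (P.vertex w) = P.vertex (g w)}
  have hclosed : ∀ n, IsClosed (C n) := by
    intro n
    have : C n = ⋂ w : List (Fin (ratDegree f)), ⋂ _ : w.length ≤ n,
        {σ | σ (P.vertex w) = P.vertex (g w)} := by
      ext σ
      simp only [C, Set.mem_iInter, Set.mem_ofPred_eq]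
    rw [this]
    exact isClosed_iInter fun w => isClosed_iInter fun _ => isClosed_setOf_apply_eq _ _
  obtain ⟨σ, hσ⟩ := IsCompact.nonempty_iInter_of_sequence_nonempty_isCompact_isClosed C
    (fun n σ h w hw => h w (hw.trans n.le_succ)) (fun n => by
      obtain ⟨h, hh, e⟩ := hg n
      obtain ⟨σ, hσ, hσv⟩ := P.mem_iteratedGaloisGroup.1 hh
      refine ⟨IntermediateField.fixingSubgroupEquiv F ⟨σ, hσ⟩, fun w hw => ?_⟩
      rw [← truncHom_eq_iff.1 e w hw]
      exact (hσv w).symm) (hclosed 0).isCompact hclosed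
  rw [Set.mem_iInter] at hσ
  exact P.mem_iteratedGaloisGroup.2
    ⟨_, ((IntermediateField.fixingSubgroupEquiv F).symm σ).2, fun w => (hσ w.length w le_rfl).symm⟩

/-! ### Fields of constants as indices -/

theorem mem_fixingSubgroup_splittingFieldUpTo {n : ℕ} {σ : Ω ≃ₐ[K] Ω} :
    σ ∈ (splittingFieldUpTo f t n).fixingSubgroup ↔
      ∀ w, w.length ≤ n → σ (P.vertex w) = P.vertex w := by
  rw [splittingFieldUpTo, mem_fixingSubgroup_adjoin]
  constructor
  · intro h w hw
    cases w with
    | nil => exact h t (Or.inl rfl)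
    | cons i w =>
      refine h _ (Or.inr (Set.mem_biUnion (x := (i :: w).length) ⟨?_, hw⟩ (P.iterate_vertex _)))
      rw [List.length_cons]
      exact Nat.succ_pos _
  · rintro h x (rfl | hx)
    · exact h [] (Nat.zero_le n)
    · simp only [Set.mem_iUnion] at hx
      obtain ⟨k, hk, hx⟩ := hx
      obtain ⟨w, rfl, rfl⟩ := P.vertex_surjective k x hx
      exact h w hk.2

theorem splittingFieldUpTo_le_splittingFieldAll (n : ℕ) :
    splittingFieldUpTo f t n ≤ splittingFieldAll f t :=
  IntermediateField.adjoin.mono _ _ _ (Set.union_subset_union_right _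
    (Set.biUnion_subset_biUnion_left fun _ hk => hk.1))

theorem mem_fixingSubgroup_splittingFieldAll {σ : Ω ≃ₐ[K] Ω} :
    σ ∈ (splittingFieldAll f t).fixingSubgroup ↔ ∀ w, σ (P.vertex w) = P.vertex w := by
  constructor
  · intro h w
    exact P.mem_fixingSubgroup_splittingFieldUpTo.1
      (IntermediateField.fixingSubgroup_le (splittingFieldUpTo_le_splittingFieldAll w.length) h)
      w le_rfl
  · rw [splittingFieldAll, mem_fixingSubgroup_adjoin]
    rintro h x (rfl | hx)
    · exact h []
    · simp only [Set.mem_iUnion] at hx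
      obtain ⟨k, -, hx⟩ := hx
      obtain ⟨w, rfl, rfl⟩ := P.vertex_surjective k x hx
      exact h w

/-- The index of the image of the geometric Galois group under a representation of the arithmetic
one is the degree of the field of constants of the field cut out by the representation. -/
theorem finrank_inf_separableClosure (ht : Transcendental K t)
    (hΩ : IsSepClosure (IntermediateField.adjoin K {t}) Ω) {Q : Type*} [Group Q]
    (q : TreeAut (Fin (ratDegree f)) →* Q) {M : IntermediateField K Ω}
    (hM : ∀ σ : Ω ≃ₐ[K] Ω, σ ∈ M.fixingSubgroup ↔
      ∃ h : σ ∈ galOver t (⊥ : IntermediateField K Ω), q (P.rep ⊥ ⟨σ, h⟩) = 1)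
    (htM : t ∈ M) :
    Module.finrank K (M ⊓ separableClosure K Ω : IntermediateField K Ω) =
      (P.geomGroup.map q).relIndex (P.arithGroup.map q) := by
  have hsep : IsSepClosed Ω := hΩ.1
  have hMgal : IsGalois M Ω := isGalois_of_mem hΩ htM
  have h0 := map_restrictNormalHom_fixingSubgroup (separableClosure K Ω) M
  let φ : galOver t (⊥ : IntermediateField K Ω) →* Gal(separableClosure K Ω/K) :=
    (AlgEquiv.restrictNormalHom (separableClosure K Ω)).comp (Subgroup.subtype _)
  -- Restriction to K^sep is onto because K(t) has no algebraic constants outside K.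
  have hφ : Function.Surjective φ := by
    have hmem : t ∈ IntermediateField.adjoin K (((⊥ : IntermediateField K Ω) : Set Ω) ∪ {t}) :=
      IntermediateField.subset_adjoin K _ (Or.inr rfl)
    have := isGalois_of_mem hΩ hmem
    have h1 := map_restrictNormalHom_fixingSubgroup (separableClosure K Ω)
      (IntermediateField.adjoin K (((⊥ : IntermediateField K Ω) : Set Ω) ∪ {t}))
    have h2 : IntermediateField.restrict (inf_le_right :
        IntermediateField.adjoin K (((⊥ : IntermediateField K Ω) : Set Ω) ∪ {t}) ⊓
          separableClosure K Ω ≤ separableClosure K Ω) = ⊥ := by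
      rw [eq_bot_iff]
      intro x hx
      rw [IntermediateField.mem_restrict] at hx
      have hle : IntermediateField.adjoin K (((⊥ : IntermediateField K Ω) : Set Ω) ∪ {t}) ≤
          IntermediateField.adjoin K {t} := by
        rw [IntermediateField.adjoin_le_iff]
        rintro y (hy | hy)
        · exact (bot_le : ⊥ ≤ IntermediateField.adjoin K {t}) hy
        · exact IntermediateField.subset_adjoin K _ hy
      have halg : IsAlgebraic K (x : Ω) :=
        (mem_separableClosure_iff.1 x.2).isIntegral.isAlgebraic
      obtain ⟨a, ha⟩ := IntermediateField.mem_bot.1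
        (mem_bot_of_mem_adjoin_transcendental ht (hle hx.1) halg)
      exact IntermediateField.mem_bot.2 ⟨a, Subtype.ext ha⟩
    rw [h2, IntermediateField.fixingSubgroup_bot] at h1
    intro τ
    obtain ⟨σ, hσ, e⟩ := h1.ge (Subgroup.mem_top τ)
    exact ⟨⟨σ, hσ⟩, e⟩
  have hker : φ.ker.map (P.rep ⊥) = P.geomGroup := by
    ext g
    rw [geomGroup, mem_iteratedGaloisGroup]
    have hφ1 : ∀ σ, σ ∈ φ.ker ↔ ∀ x ∈ separableClosure K Ω, σ.1 x = x := by
      intro σ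
      have hc : ∀ x : separableClosure K Ω, (φ σ x : Ω) = σ.1 x := fun x =>
        AlgEquiv.restrictNormal_commutes σ.1 (separableClosure K Ω) x
      rw [MonoidHom.mem_ker]
      constructor
      · intro h x hx
        have := hc ⟨x, hx⟩
        rw [h] at this
        exact this.symm
      · intro h
        ext x
        rw [hc, h x x.2]
        rfl
    constructor
    · rintro ⟨σ, hσ, rfl⟩
      exact ⟨σ.1, mem_galOver.2 ⟨(hφ1 σ).1 hσ, galOver_apply t _ σ⟩, P.vertex_rep ⊥ σ⟩
    · rintro ⟨σ, hσ, h⟩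
      rw [mem_galOver] at hσ
      exact ⟨⟨σ, mem_galOver_bot.2 hσ.2⟩, (hφ1 _).2 hσ.1, P.eq_rep_iff.2 h⟩
  have hmap : (q.comp (P.rep ⊥)).ker.map φ =
      M.fixingSubgroup.map (AlgEquiv.restrictNormalHom (separableClosure K Ω)) := by
    ext τ
    constructor
    · rintro ⟨σ, hσ, rfl⟩
      exact ⟨σ.1, (hM _).2 ⟨σ.2, hσ⟩, rfl⟩
    · rintro ⟨σ, hσ, rfl⟩
      obtain ⟨h, h'⟩ := (hM σ).1 hσ
      exact ⟨⟨σ, h⟩, h', rfl⟩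
  -- The kernel of restriction to K^sep gives H under the representation, while the kernel of q on
  -- Galois elements fixes M and restricts to the group of M ∩ K^sep.
  have hidx := relIndex_map_ker (q.comp (P.rep ⊥)) φ hφ
  rw [hmap, h0, ← IntermediateField.finrank_eq_fixingSubgroup_index, ← Subgroup.map_map, hker,
    MonoidHom.range_comp] at hidx
  rw [arithGroup, iteratedGaloisGroup, hidx]
  exact (IntermediateField.restrictAlgEquiv _).toLinearEquiv.finrank_eq

theorem finrank_constantField (ht : Transcendental K t)
    (hΩ : IsSepClosure (IntermediateField.adjoin K {t}) Ω) :
    Module.finrank K (constantField f t) = P.geomGroup.relIndex P.arithGroup := by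
  have h := P.finrank_inf_separableClosure ht hΩ (MonoidHom.id _) (M := splittingFieldAll f t)
    (fun σ => by
      rw [P.mem_fixingSubgroup_splittingFieldAll]
      constructor
      · intro h
        exact ⟨mem_galOver_bot.2 (h []), P.eq_rep_iff.2 fun w => (h w).symm⟩
      · rintro ⟨h, h'⟩ w
        exact (P.eq_rep_iff.1 h' w).symm)
    (IntermediateField.subset_adjoin K _ (Or.inl rfl))
  rwa [Subgroup.map_id, Subgroup.map_id] at h

theorem finrank_splittingFieldUpTo_inf_separableClosure (ht : Transcendental K t)
    (hΩ : IsSepClosure (IntermediateField.adjoin K {t}) Ω) (n : ℕ) :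
    Module.finrank K (splittingFieldUpTo f t n ⊓ separableClosure K Ω : IntermediateField K Ω) =
      (P.geomGroup.map (truncHom _ n)).relIndex (P.arithGroup.map (truncHom _ n)) := by
  refine P.finrank_inf_separableClosure ht hΩ (truncHom _ n) (fun σ => ?_)
    (IntermediateField.subset_adjoin K _ (Or.inl rfl))
  rw [P.mem_fixingSubgroup_splittingFieldUpTo]
  constructor
  · intro h
    refine ⟨mem_galOver_bot.2 (h [] (Nat.zero_le n)), truncHom_eq_one_iff.2 fun w hw => ?_⟩
    apply P.vertex_injective
    · rw [TreeAut.length_apply]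
    · rw [vertex_rep]
      exact h w hw
  · rintro ⟨h, h'⟩ w hw
    have h1 := P.vertex_rep ⊥ ⟨σ, h⟩ w
    rw [truncHom_eq_one_iff.1 h' w hw] at h1
    exact h1.symm

end PathSystem

end IteratedGalois

theorem theorem1 {K Ω : Type*} [Field K] [Field Ω] [Algebra K Ω] (t : Ω)
    (ht : Transcendental K t) (hΩ : IsSepClosure (IntermediateField.adjoin K {t}) Ω)
    (f : RatFunc K) (hd : 2 ≤ ratDegree f) (hf : IsSeparableRat f) (P : PathSystem f t) :
    (IsBranch P.geomGroup ↔ IsBranch P.arithGroup) ∧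
    (IsBranch P.geomGroup ∨ IsBranch P.arithGroup →
      (∃ D : ℕ, IsOfFiniteType P.geomGroup D) ∧
      ∀ D : ℕ, IsOfFiniteType P.geomGroup D →
        FiniteDimensional K (constantField f t) ∧
        (P.geomGroup.subgroupOf P.arithGroup).FiniteIndex ∧
        Module.finrank K (constantField f t) = P.geomGroup.relIndex P.arithGroup ∧
        P.geomGroup.relIndex P.arithGroup =
          (P.geomGroup.map (truncHom _ D)).relIndex (P.arithGroup.map (truncHom _ D)) ∧
        constantField f t = splittingFieldUpTo f t D ⊓ separableClosure K Ω) := by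
  have : Nontrivial (Fin (ratDegree f)) := Fin.nontrivial_iff_two_le.2 hd
  have hle := P.geomGroup_le_arithGroup
  have hs : ∀ g ∈ P.arithGroup, ∀ v, g⁻¹ * g.sect v ∈ P.geomGroup := fun g hg v =>
    P.inv_mul_sect_mem_geomGroup hg v
  have hft : IsBranch P.geomGroup → ∃ D : ℕ, IsOfFiniteType P.geomGroup D := fun h =>
    h.exists_isOfFiniteType (P.isSelfReplicating le_rfl) (P.isLevelClosed hΩ _)
  have hiff : IsBranch P.geomGroup ↔ IsBranch P.arithGroup := by
    refine ⟨fun h => ?_, fun h => h.of_sect hle P.isLevelTransitive_geomGroup hs⟩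
    obtain ⟨D, hD⟩ := hft h
    exact h.of_relIndex_ne_zero hle (relIndex_ne_zero_of_isOfFiniteType hD hs)
  refine ⟨hiff, fun h => ⟨hft (h.elim id hiff.2), fun D hD => ?_⟩⟩
  have hne := relIndex_ne_zero_of_isOfFiniteType hD hs
  have hrank := P.finrank_constantField ht hΩ
  -- The value 0 of `finrank` and of `relIndex` stands for infinity, so a nonzero index yields
  -- finiteness of the extension.
  have hfin : FiniteDimensional K (constantField f t) :=
    FiniteDimensional.of_finrank_pos (Nat.pos_of_ne_zero (hrank.trans_ne hne))
  refine ⟨hfin, ⟨hne⟩, hrank, relIndex_map_truncHom hD hs, ?_⟩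
  have hsub : splittingFieldUpTo f t D ⊓ separableClosure K Ω ≤ constantField f t :=
    inf_le_inf_right _ (PathSystem.splittingFieldUpTo_le_splittingFieldAll D)
  refine (IntermediateField.eq_of_le_of_finrank_eq hsub ?_).symm
  rw [P.finrank_splittingFieldUpTo_inf_separableClosure ht hΩ D, ← relIndex_map_truncHom hD hs]
  exact hrank.symm
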